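/- Let $T$ be a tree (a connected acyclic graph) in which every vertex has finitely many neighbours, with a reference vertex $x_0$. For a vertex $x$ let $S(x)$ be the set of its children, that is, of its neighbours other than its parent (the neighbour of $x\ne x_0$ on the path from $x_0$ to $x$), and suppose that $S(x)$ has at least two elements for every $x$. Let numbers $q(x,y)>0$, $y\in S(x)$, be given with $\sum_{y\in S(x)}q(x,y)=1$ for every vertex $x$, and put $q(x,y)=0$ if $y$ is the parent of $x$. Let $\partial T$ be the set of infinite geodesics $e=(y_0,y_1,\dots)$ with $y_0=x_0$ and $y_{n+1}\in S(y_n)$, let $B_x=\{e\in\partial T: x\in e\}$, let $\mathcal M$ be the $\sigma$-algebra on $\partial T$ generated by the sets $B_x$, and let $\mathbb P$ be the unique probability measure on $\mathcal M$ with $\mathbb P(B_{x})=\prod_{j=0}^{n-1}q(y_j,y_{j+1})$ whenever $(y_0,\dots,y_n)$ is the path from $y_0=x_0$ to $y_n=x$. Let $E$ be a separable Fréchet space over $\mathbb R$ or $\mathbb C$, with a complete translation-invariant metric $d$ that defines its topology. Let $H_Q(T,E)$ be the vector space of harmonic functions, that is, of the functions $f:T\to E$ with $f(x)=\sum_{y\in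 S(x)}q(x,y)f(y)$ for every vertex $x$, with the topology of pointwise convergence. For $f\in H_Q(T,E)$ and $n\ge0$ let $\omega_n(f):\partial T\to E$, $\omega_n(f)(e)=f(y_n)$ for $e=(y_0,y_1,\dots)$. Let $L^0(\partial T,E)$ be the space of $\mathcal M$-measurable functions $\partial T\to E$ modulo $\mathbb P$-almost everywhere equality, with the metric $\tilde\rho(g,h)=\int_{\partial T}\frac{d(g,h)}{1+d(g,h)}\,d\mathbb P$ of convergence in probability. Let $U(T,E)$ be the set of universal functions, that is, of those $f\in H_Q(T,E)$ for which the sequence $\omega_n(f)$, $n=0,1,2,\dots$, is dense in $L^0(\partial T,E)$. Then $U(T,E)\cup\{0\}$ contains a vector subspace that is dense in $H_Q(T,E)$. Moreover, for $E=\mathbb C$ and for every infinite set $\tau\subseteq\mathbb N=\{0,1,2,\dots\}$, let $\widetilde U_\tau(T)$ be the class of those $f\in H_Q(T,\mathbb C)$ such that for every $\mathcal M$-measurable $\Psi:\partial T\to\mathbb C$ there is a sequence $(\lambda_n)$ in $\tau$ for which $\omega_{\lambda_n}(f)$ converges to $\Psi$ in probability. Then $\widetilde U_\tau(T)\cup\{0\}$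 contains a complex vector subspace that is dense in $H_Q(T,\mathbb C)$. -/

import Mathlib

open Filter Topology MeasureTheory

noncomputable section

/-- A locally finite tree (connected, acyclic simple graph) with a reference vertex, such that
every vertex has at least two children. The vertices at distance one more from the root than `x`
are exactly the neighbours of `x` other than its parent. -/
structure BranchingTree (V : Type*) where
  graph : SimpleGraph V
  isTree : graph.IsTree
  root : V
  finite_neighborSet : ∀ x, (graph.neighborSet x).Finite
  two_le_ncard : ∀ x,
    2 ≤ {y | graph.Adj x y ∧ graph.dist root y = graph.dist root x + 1}.ncard

namespace BranchingTree

variable {V : Type*} (T : BranchingTree V)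

/-- The set `S(x)` of children of `x`. -/
def children (x : V) : Finset V :=
  (Set.Finite.subset (T.finite_neighborSet x)
    (t := {y | T.graph.Adj x y ∧ T.graph.dist T.root y = T.graph.dist T.root x + 1})
    (fun _ hy => hy.1)).toFinset

theorem mem_children {x y : V} : y ∈ T.children x ↔
    T.graph.Adj x y ∧ T.graph.dist T.root y = T.graph.dist T.root x + 1 := by
  simp [children]

/-- The type of the children of `x`, with the discrete σ-algebra. -/
abbrev Child (x : V) : Type _ := {y // y ∈ T.children x}

instance (x : V) : MeasurableSpace (T.Child x) := ⊤

/-- `T_n`, the set of vertices at distance `n` from the root. -/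
def level (n : ℕ) : Set V := {x | T.graph.dist T.root x = n}

/-- The vertices other than the root are children of one vertex only. -/
theorem parent_unique {x x' y : V} (h : y ∈ T.children x) (h' : y ∈ T.children x') :
    x = x' := by
  rw [mem_children] at h h'
  have key : ∀ z, T.graph.Adj z y ∧ T.graph.dist T.root y = T.graph.dist T.root z + 1 →
      ∃ p : T.graph.Walk T.root y, p.IsPath ∧ p.penultimate = z := by
    rintro z ⟨hz, hd⟩
    obtain ⟨p, hp, hl⟩ := T.isTree.connected.exists_path_of_dist T.root z
    refine ⟨p.concat hz, hp.concat ?_ hz, p.penultimate_concat hz⟩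
    intro hy
    classical
    have h1 : T.graph.dist T.root y ≤ (p.takeUntil y hy).length := SimpleGraph.dist_le _
    have h2 := p.length_takeUntil_le_length hy
    omega
  obtain ⟨p, hp, rfl⟩ := key x h
  obtain ⟨p', hp', rfl⟩ := key x' h'
  rw [(T.isTree.existsUnique_path _ _).unique hp hp']

/-- The boundary `∂T`: the infinite geodesics starting at the root. -/
def Boundary : Type _ :=
  {e : ℕ → V // e 0 = T.root ∧ ∀ n, e (n + 1) ∈ T.children (e n)}

variable {T}

/-- The `n`-th vertex of a boundary point, i.e. the only element of `e ∩ T_n`. -/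
def Boundary.vertex (e : T.Boundary) (n : ℕ) : V := e.1 n

variable (T)

/-- The boundary sector `B_x` of all the geodesics through `x`. -/
def sector (x : V) : Set T.Boundary := {e | ∃ n, e.vertex n = x}

/-- The σ-algebra `M_n` generated by the sectors `B_x`, `x ∈ T_n`. -/
@[reducible]
def levelSigma (n : ℕ) : MeasurableSpace T.Boundary :=
  MeasurableSpace.generateFrom (T.sector '' T.level n)

/-- The σ-algebra `M` generated by the union of all the `M_n`. -/
instance : MeasurableSpace T.Boundary := ⨆ n, T.levelSigma n

variable {T}

theorem Boundary.dist_vertex (e : T.Boundary) (n : ℕ) :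
    T.graph.dist T.root (e.vertex n) = n := by
  induction n with
  | zero => rw [Boundary.vertex, e.2.1]; simp
  | succ n ih =>
    have h := (T.mem_children.1 (e.2.2 n)).2
    change _ = T.graph.dist T.root (e.vertex n) + 1 at h
    rw [ih] at h
    exact h

theorem mem_sector_vertex {e e' : T.Boundary} {n : ℕ} :
    e' ∈ T.sector (e.vertex n) ↔ e'.vertex n = e.vertex n := by
  refine ⟨?_, fun h => ⟨n, h⟩⟩
  rintro ⟨m, hm⟩
  have h := e'.dist_vertex m
  rw [hm, e.dist_vertex] at h
  subst h
  exact hm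

theorem vertex_eq_of_le {e e' : T.Boundary} {n : ℕ} (h : e'.vertex n = e.vertex n) {j : ℕ}
    (hj : j ≤ n) : e'.vertex j = e.vertex j := by
  induction n with
  | zero => obtain rfl : j = 0 := by omega
            exact h
  | succ n ih =>
    rcases Nat.lt_or_ge n j with h1 | h1
    · obtain rfl : j = n + 1 := by omega
      exact h
    · refine ih ?_ h1
      have a := e'.2.2 n
      have b := e.2.2 n
      change e'.vertex (n + 1) ∈ T.children (e'.vertex n) at a
      change e.vertex (n + 1) ∈ T.children (e.vertex n) at b
      rw [h] at a
      exact T.parent_unique a b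

theorem finite_range_vertex (n : ℕ) : (Set.range fun e : T.Boundary => e.vertex n).Finite := by
  induction n with
  | zero =>
    refine (Set.finite_singleton T.root).subset ?_
    rintro _ ⟨e, rfl⟩
    exact e.2.1
  | succ n ih =>
    refine (ih.biUnion fun x _ => (T.children x).finite_toSet).subset ?_
    rintro _ ⟨e, rfl⟩
    simp only [Set.mem_iUnion]
    exact ⟨e.vertex n, ⟨e, rfl⟩, e.2.2 n⟩

theorem measurableSet_sector (e : T.Boundary) (n : ℕ) :
    MeasurableSet (T.sector (e.vertex n)) := by
  have : MeasurableSet[T.levelSigma n] (T.sector (e.vertex n)) :=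
    MeasurableSpace.measurableSet_generateFrom ⟨_, e.dist_vertex n, rfl⟩
  exact le_iSup T.levelSigma n _ this

/-- A function of the `n`-th vertex is measurable. -/
theorem measurable_vertex {α : Type*} [MeasurableSpace α] (f : V → α) (n : ℕ) :
    Measurable fun e : T.Boundary => f (e.vertex n) := by
  intro s _
  have h : (fun e : T.Boundary => f (e.vertex n)) ⁻¹' s =
      ⋃ x ∈ (Set.range fun e : T.Boundary => e.vertex n) ∩ f ⁻¹' s,
        {e : T.Boundary | e.vertex n = x} := by
    ext e; simp
  rw [h]
  refine ((finite_range_vertex n).inter_of_left _).measurableSet_biUnion ?_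
  rintro _ ⟨⟨e, rfl⟩, _⟩
  have : {e' : T.Boundary | e'.vertex n = e.vertex n} = T.sector (e.vertex n) := by
    ext e'; exact mem_sector_vertex.symm
  change MeasurableSet {e' : T.Boundary | e'.vertex n = e.vertex n}
  rw [this]
  exact measurableSet_sector e n

/-- The boundary point obtained by following at each vertex the prescribed child. -/
def follow (T : BranchingTree V) (ω : ∀ x, T.Child x) : T.Boundary :=
  ⟨fun n => Nat.rec T.root (fun _ x => (ω x).1) n, rfl, fun _ => (ω _).2⟩

theorem follow_succ (ω : ∀ x, T.Child x) (n : ℕ) :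
    (T.follow ω).vertex (n + 1) = (ω ((T.follow ω).vertex n)).1 := rfl

theorem follow_mem_sector (e : T.Boundary) (n : ℕ) (ω : ∀ x, T.Child x) :
    T.follow ω ∈ T.sector (e.vertex n) ↔
      ∀ j < n, (ω (e.vertex j)).1 = e.vertex (j + 1) := by
  rw [mem_sector_vertex]
  constructor
  · intro h j hj
    have h1 := vertex_eq_of_le h (j := j) (by omega)
    have h2 := vertex_eq_of_le h (j := j + 1) (by omega)
    rw [← h2, follow_succ, h1]
  · intro h
    induction n with
    | zero => exact e.2.1.symm
    | succ n ih =>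
      rw [follow_succ, ih fun j hj => h j (by omega)]
      exact h n (by omega)

end BranchingTree

/-- The numbers `q(x,y)`: positive for `y ∈ S(x)`, zero for the parent of `x`, and of sum `1` over
`S(x)`. -/
structure TransitionWeights {V : Type*} (T : BranchingTree V) where
  q : V → V → ℝ
  pos : ∀ x, ∀ y ∈ T.children x, 0 < q x y
  parent : ∀ x y, T.graph.Adj x y → y ∉ T.children x → q x y = 0
  sum_eq_one : ∀ x, ∑ y ∈ T.children x, q x y = 1

namespace TransitionWeights

variable {V : Type*} {T : BranchingTree V} (Q : TransitionWeights T)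

/-- The law on the children of `x` with weights `q(x,y)`. -/
def childMeasure (x : V) : Measure (T.Child x) :=
  ∑ y : T.Child x, ENNReal.ofReal (Q.q x y) • Measure.dirac y

theorem childMeasure_singleton (x : V) (y : T.Child x) :
    Q.childMeasure x {y} = ENNReal.ofReal (Q.q x y) := by
  classical
  simp only [childMeasure, Measure.coe_finsetSum, Finset.sum_apply, Measure.smul_apply,
    smul_eq_mul]
  rw [Finset.sum_eq_single y]
  · rw [Measure.dirac_apply' _ (show MeasurableSet ({y} : Set (T.Child x)) from trivial)]
    simp
  · intro z _ hz
    rw [Measure.dirac_apply' _ (show MeasurableSet ({y} : Set (T.Child x)) from trivial)]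
    rw [Set.indicator_of_notMem (by simpa using hz), mul_zero]
  · intro h
    exact absurd (Finset.mem_univ _) h

instance (x : V) : IsProbabilityMeasure (Q.childMeasure x) := by
  constructor
  simp only [childMeasure, Measure.coe_finsetSum, Finset.sum_apply, Measure.smul_apply,
    smul_eq_mul, measure_univ, mul_one]
  rw [← ENNReal.ofReal_sum_of_nonneg fun y _ => (Q.pos x y.1 y.2).le,
    ← Finset.attach_eq_univ, Finset.sum_attach (T.children x) (fun y => Q.q x y),
    Q.sum_eq_one, ENNReal.ofReal_one]

/-- The probability measure `P` on the boundary: the law of the random geodesic that moves from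
`x` to its child `y` with probability `q(x,y)`, independently at all the vertices. By
`boundaryMeasure_sector`, it is the measure with `P(B_x) = ∏ q(y_j, y_{j+1})`, where the `y_j`
are the vertices on the geodesic from the root to `x`; see also `eq_boundaryMeasure`. -/
def boundaryMeasure : Measure T.Boundary :=
  (Measure.infinitePi Q.childMeasure).map T.follow

theorem preimage_sector (e : T.Boundary) (n : ℕ) :
    ∃ s : Finset V, ∃ t : ∀ x, Set (T.Child x),
      T.follow ⁻¹' (T.sector (e.vertex n)) = (s : Set V).pi t ∧
      ∏ x ∈ s, Q.childMeasure x (t x) =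
        ∏ j ∈ Finset.range n, ENNReal.ofReal (Q.q (e.vertex j) (e.vertex (j + 1))) := by
  classical
  have inj : Function.Injective e.vertex := fun i j h => by
    rw [← e.dist_vertex i, h, e.dist_vertex]
  refine ⟨(Finset.range n).image e.vertex,
    fun x => {y | ∀ j, e.vertex j = x → y.1 = e.vertex (j + 1)}, ?_, ?_⟩
  · ext ω
    rw [Set.mem_preimage, BranchingTree.follow_mem_sector]
    simp only [Set.mem_pi, Finset.coe_image, Finset.coe_range, Set.mem_image, Set.mem_Iio,
      Set.mem_ofPred_eq]
    constructor
    · rintro h _ ⟨j, hj, rfl⟩ i hi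
      rw [inj hi]
      exact h j hj
    · intro h j hj
      exact h _ ⟨j, hj, rfl⟩ j rfl
  · rw [Finset.prod_image fun i _ j _ h => inj h]
    refine Finset.prod_congr rfl fun j _ => ?_
    rw [← Q.childMeasure_singleton (e.vertex j) ⟨e.vertex (j + 1), e.2.2 j⟩]
    congr 1
    ext y
    simp only [Set.mem_ofPred_eq, Set.mem_singleton_iff]
    constructor
    · intro h
      exact Subtype.ext (h j rfl)
    · rintro rfl i hi
      rw [inj hi]

theorem measurable_follow (Q : TransitionWeights T) : Measurable T.follow := by
  refine Measurable.of_le_map (iSup_le fun n => MeasurableSpace.generateFrom_le ?_)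
  rintro _ ⟨x, hx, rfl⟩
  change MeasurableSet (T.follow ⁻¹' _)
  by_cases h : (T.sector x).Nonempty
  · obtain ⟨e, m, rfl⟩ := h
    obtain ⟨s, t, h1, -⟩ := Q.preimage_sector e m
    rw [h1]
    exact MeasurableSet.pi s.countable_toSet fun _ _ => trivial
  · rw [Set.not_nonempty_iff_eq_empty.1 h]
    simp

instance : IsProbabilityMeasure Q.boundaryMeasure :=
  Measure.isProbabilityMeasure_map Q.measurable_follow.aemeasurable

theorem boundaryMeasure_sector (e : T.Boundary) (n : ℕ) :
    Q.boundaryMeasure (T.sector (e.vertex n)) =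
      ∏ j ∈ Finset.range n, ENNReal.ofReal (Q.q (e.vertex j) (e.vertex (j + 1))) := by
  obtain ⟨s, t, h1, h2⟩ := Q.preimage_sector e n
  rw [boundaryMeasure, Measure.map_apply Q.measurable_follow (BranchingTree.measurableSet_sector e n),
    h1, Measure.infinitePi_pi Q.childMeasure (fun _ _ => trivial), h2]

theorem eq_boundaryMeasure (μ : Measure T.Boundary) [IsProbabilityMeasure μ]
    (hμ : ∀ (e : T.Boundary) (n : ℕ), μ (T.sector (e.vertex n)) =
      ∏ j ∈ Finset.range n, ENNReal.ofReal (Q.q (e.vertex j) (e.vertex (j + 1)))) :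
    μ = Q.boundaryMeasure := by
  refine ext_of_generate_finite (insert ∅ {A | ∃ (e : T.Boundary) (n : ℕ), A = T.sector (e.vertex n)})
    ?_ ?_ ?_ (by simp)
  · apply le_antisymm
    · refine iSup_le fun n => MeasurableSpace.generateFrom_le ?_
      rintro _ ⟨x, hx, rfl⟩
      by_cases h : (T.sector x).Nonempty
      · obtain ⟨e, m, rfl⟩ := h
        exact MeasurableSpace.measurableSet_generateFrom (Or.inr ⟨e, m, rfl⟩)
      · rw [Set.not_nonempty_iff_eq_empty.1 h]
        simp
    · refine MeasurableSpace.generateFrom_le ?_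
      rintro _ (rfl | ⟨e, n, rfl⟩)
      · simp
      · exact BranchingTree.measurableSet_sector e n
  · rintro _ (rfl | ⟨e, n, rfl⟩) _ (rfl | ⟨e', m, rfl⟩) ⟨a, ha, hb⟩
    · exact ha.elim
    · exact ha.elim
    · exact hb.elim
    · have ha' := BranchingTree.mem_sector_vertex.1 ha
      have hb' := BranchingTree.mem_sector_vertex.1 hb
      right
      refine ⟨a, max n m, ?_⟩
      ext z
      rw [Set.mem_inter_iff, BranchingTree.mem_sector_vertex, BranchingTree.mem_sector_vertex,
        BranchingTree.mem_sector_vertex, ← ha', ← hb']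
      constructor
      · rintro ⟨h1, h2⟩
        rcases max_choice n m with h | h <;> rw [h] <;> assumption
      · intro h
        exact ⟨BranchingTree.vertex_eq_of_le h (le_max_left _ _),
          BranchingTree.vertex_eq_of_le h (le_max_right _ _)⟩
  · rintro _ (rfl | ⟨e, n, rfl⟩)
    · simp
    · rw [hμ, boundaryMeasure_sector]

variable (𝕜 E : Type*) [RCLike 𝕜] [AddCommGroup E] [Module 𝕜 E]

/-- The space `H_Q(T,E)` of harmonic functions, as a subspace of `E^T`. -/
def harmonic : Submodule 𝕜 (V → E) where
  carrier := {f | ∀ x, f x = ∑ y ∈ T.children x, (Q.q x y : 𝕜) • f y}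
  add_mem' {f g} hf hg x := by
    simp only [Pi.add_apply, smul_add, Finset.sum_add_distrib]
    rw [← hf x, ← hg x]
  zero_mem' x := by simp
  smul_mem' c f hf x := by
    simp only [Pi.smul_apply]
    rw [hf x, Finset.smul_sum]
    exact Finset.sum_congr rfl fun y _ => smul_comm _ _ _

end TransitionWeights

/-- The space `L⁰(μ, E)` of classes of measurable functions modulo almost everywhere equality. It
carries the topology of convergence in probability. -/
def LZero {Ω : Type*} [MeasurableSpace Ω] (E : Type*) [MetricSpace E] (μ : Measure Ω) : Type _ :=
  Ω →ₘ[μ] E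

namespace LZero

variable {Ω : Type*} [MeasurableSpace Ω] {E : Type*} [MetricSpace E] {μ : Measure Ω}

/-- The class of a function. -/
def mk (f : Ω → E) (hf : AEStronglyMeasurable f μ) : LZero E μ := AEEqFun.mk f hf

/-- The coercion to functions: some representative. -/
def toFun (h : LZero E μ) : Ω → E := AEEqFun.cast h

theorem aestronglyMeasurable (h : LZero E μ) : AEStronglyMeasurable h.toFun μ :=
  AEEqFun.aestronglyMeasurable h

variable [IsFiniteMeasure μ]

theorem integrable_dist (g h : LZero E μ) :
    Integrable (fun ω => dist (g.toFun ω) (h.toFun ω) /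
      (1 + dist (g.toFun ω) (h.toFun ω))) μ := by
  have hm : AEStronglyMeasurable (fun ω => dist (g.toFun ω) (h.toFun ω)) μ :=
    g.aestronglyMeasurable.dist h.aestronglyMeasurable
  refine Integrable.of_bound (C := 1)
    (hm.aemeasurable.div (hm.aemeasurable.const_add 1)).aestronglyMeasurable ?_
  refine Eventually.of_forall fun ω => ?_
  have h0 : 0 ≤ dist (g.toFun ω) (h.toFun ω) := dist_nonneg
  rw [Real.norm_of_nonneg (by positivity)]
  exact (div_le_one (by positivity)).2 (by linarith)

/-- The metric `∫ d(g,h) / (1 + d(g,h)) dμ` of convergence in probability. -/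
instance : MetricSpace (LZero E μ) where
  dist g h := ∫ ω, dist (g.toFun ω) (h.toFun ω) / (1 + dist (g.toFun ω) (h.toFun ω)) ∂μ
  dist_self g := by simp
  dist_comm g h := by simp only [dist_comm]
  dist_triangle f g h := by
    rw [← integral_add (integrable_dist f g) (integrable_dist g h)]
    refine integral_mono (integrable_dist f h) ((integrable_dist f g).add (integrable_dist g h)) ?_
    intro ω
    have key : ∀ a b c : ℝ, 0 ≤ a → 0 ≤ b → 0 ≤ c → c ≤ a + b →
        c / (1 + c) ≤ a / (1 + a) + b / (1 + b) := by
      intro a b c ha hb hc ht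
      calc c / (1 + c) ≤ (a + b) / (1 + (a + b)) := by
            rw [div_le_div_iff₀ (by positivity) (by positivity)]
            nlinarith
        _ = a / (1 + (a + b)) + b / (1 + (a + b)) := add_div _ _ _
        _ ≤ a / (1 + a) + b / (1 + b) := by
            gcongr <;> linarith
    exact key _ _ _ dist_nonneg dist_nonneg dist_nonneg (dist_triangle _ _ _)
  eq_of_dist_eq_zero {g h} hgh := by
    change ∫ ω, dist (g.toFun ω) (h.toFun ω) / (1 + dist (g.toFun ω) (h.toFun ω)) ∂μ = 0 at hgh
    rw [integral_eq_zero_iff_of_nonneg (fun ω => by positivity) (integrable_dist g h)] at hgh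
    refine AEEqFun.ext (hgh.mono fun ω hω => ?_)
    have h0 : 0 ≤ dist (g.toFun ω) (h.toFun ω) := dist_nonneg
    rcases div_eq_zero_iff.1 hω with h1 | h1
    · exact dist_eq_zero.1 h1
    · linarith

end LZero

namespace BranchingTree

variable {V : Type*} {T : BranchingTree V} {E : Type*}

/-- The function `ω_n(f)` on the boundary, `ω_n(f)(e) = f(y_n)` for the vertex `y_n ∈ e ∩ T_n`. -/
def boundaryFun (T : BranchingTree V) (n : ℕ) (f : V → E) : T.Boundary → E :=
  fun e => f (e.vertex n)

theorem aestronglyMeasurable_boundaryFun [MetricSpace E] [TopologicalSpace.SeparableSpace E]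
    (n : ℕ) (f : V → E) (μ : Measure T.Boundary) :
    AEStronglyMeasurable (T.boundaryFun n f) μ := by
  have := UniformSpace.secondCountable_of_separable E
  borelize E
  exact (measurable_vertex f n).stronglyMeasurable.aestronglyMeasurable

end BranchingTree

namespace TransitionWeights

variable {V : Type*} {T : BranchingTree V} (Q : TransitionWeights T)

/-- The set `U(T,E)` of universal harmonic functions: those `f` for which the sequence `ω_n(f)`,
`n = 0, 1, 2, …`, is dense in `L⁰(∂T,E)`. -/
def universal (𝕜 E : Type*) [RCLike 𝕜] [AddCommGroup E] [Module 𝕜 E] [MetricSpace E]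
    [TopologicalSpace.SeparableSpace E] : Set (Q.harmonic 𝕜 E) :=
  {f | DenseRange fun n : ℕ => LZero.mk (μ := Q.boundaryMeasure) (T.boundaryFun n (f : V → E))
    (BranchingTree.aestronglyMeasurable_boundaryFun n _ _)}

/-- The class of the complex harmonic functions `f` such that each measurable function on the
boundary is the limit in probability of a sequence `ω_{λ_n}(f)` with all `λ_n` in `τ`. -/
def universalAlong (τ : Set ℕ) : Set (Q.harmonic ℂ ℂ) :=
  {f | ∀ Ψ : T.Boundary → ℂ, Measurable Ψ → ∃ l : ℕ → ℕ, (∀ n, l n ∈ τ) ∧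
    TendstoInMeasure Q.boundaryMeasure (fun n => T.boundaryFun (l n) (f : V → ℂ)) atTop Ψ}

end TransitionWeights

end

/-! ### Cylinder sets and approximation by functions of a vertex -/

namespace BranchingTree

variable {V : Type*} {T : BranchingTree V}

/-! A harmonic function is a vector-valued martingale, and beyond any level it can be steered
towards a prescribed target. At each vertex choose a child reached with probability `q ≤ 1/2`. On
moving to it, multiply the deviation from the target by `1/q`; on moving to any other child, set the
deviation to `0`. The mean is preserved, so the function stays harmonic, and after `k` steps the
deviation survives only with probability at most a constant times `2⁻ᵏ`
(`exists_harmonic_tendsto_measure_ne`).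

Countably many functions of a vertex suffice to approximate every measurable function in probability
(`exists_denseSeq_dist_lt`). Steering infinitely often to each of them gives a function that is
universal along any given sequence of levels and has prescribed values up to a level. With `0` among
the targets, it also becomes null along a subsequence (`exists_universalAlongSeq`).

For a linear space, choose `f₀, f₁, …` and nested subsequences `s₀, s₁, …` of levels such that `fₙ`
is universal along `sₙ` and null along `sₙ₊₁`. In a combination with last nonzero term `a • fₙ`, all
earlier terms are null along `sₙ`, so the combination inherits universality from `fₙ`. Density
follows by letting the `fₙ` agree up to high levels with members of a dense sequence. -/

theorem exists_mem_children {y : V} {n : ℕ} (h : T.graph.dist T.root y = n + 1) :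
    ∃ x, y ∈ T.children x := by
  obtain ⟨p, hp⟩ := T.isTree.connected.exists_walk_length_eq_dist T.root y
  have hn : ¬ p.Nil := by
    rw [← SimpleGraph.Walk.length_eq_zero_iff]; omega
  have hadj : T.graph.Adj p.penultimate y := p.adj_penultimate hn
  refine ⟨p.penultimate, T.mem_children.2 ⟨hadj, ?_⟩⟩
  have h1 : T.graph.dist T.root p.penultimate ≤ n := by
    refine (SimpleGraph.dist_le p.dropLast).trans ?_
    have : p.dropLast.length + 1 = p.length := p.length_dropLast_add_one hn
    omega
  have h2 : T.graph.dist T.root y ≤ T.graph.dist T.root p.penultimate + T.graph.dist p.penultimate y :=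
    T.isTree.connected.dist_triangle
  rw [SimpleGraph.dist_eq_one_iff_adj.2 hadj] at h2
  omega

theorem finite_level (T : BranchingTree V) (n : ℕ) : (T.level n).Finite := by
  induction n with
  | zero =>
    refine (Set.finite_singleton T.root).subset fun x hx => ?_
    exact ((T.isTree.connected.preconnected _ _).dist_eq_zero_iff.1 hx).symm
  | succ n ih =>
    refine (ih.biUnion fun x _ => (T.children x).finite_toSet).subset fun y hy => ?_
    obtain ⟨x, hx⟩ := exists_mem_children hy
    simp only [Set.mem_iUnion]
    refine ⟨x, ?_, hx⟩
    have := (T.mem_children.1 hx).2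
    have hy : T.graph.dist T.root y = n + 1 := hy
    change T.graph.dist T.root x = n
    omega

theorem countable_vertices (T : BranchingTree V) : Countable V := by
  have : (Set.univ : Set V) = ⋃ n, T.level n := by
    ext x
    simp only [Set.mem_univ, Set.mem_iUnion, true_iff]
    exact ⟨_, rfl⟩
  rw [← Set.countable_univ_iff, this]
  exact Set.countable_iUnion fun n => (T.finite_level n).countable

open Classical in
/-- The parent of a vertex (the vertex itself, in the case of the root). -/
noncomputable def parent (T : BranchingTree V) (y : V) : V :=
  if h : ∃ x, y ∈ T.children x then h.choose else y

theorem parent_eq {x y : V} (h : y ∈ T.children x) : T.parent y = x := by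
  have hex : ∃ x, y ∈ T.children x := ⟨x, h⟩
  rw [parent, dif_pos hex]
  exact T.parent_unique hex.choose_spec h

theorem dist_of_mem_children {x y : V} (h : y ∈ T.children x) :
    T.graph.dist T.root y = T.graph.dist T.root x + 1 :=
  (T.mem_children.1 h).2

theorem Boundary.vertex_mem_children (e : T.Boundary) (n : ℕ) :
    e.vertex (n + 1) ∈ T.children (e.vertex n) := e.2.2 n

theorem Boundary.iterate_parent_vertex (e : T.Boundary) (n k : ℕ) :
    T.parent^[k] (e.vertex (n + k)) = e.vertex n := by
  induction k with
  | zero => rfl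
  | succ k ih =>
    rw [Function.iterate_succ_apply, ← add_assoc, parent_eq (e.vertex_mem_children (n + k)), ih]

/-- A function of the `m`-th vertex is a function of each later vertex. -/
theorem exists_vertex_eq_of_le {α : Type*} {m n : ℕ} (h : m ≤ n) (φ : V → α) :
    ∃ φ' : V → α, ∀ e : T.Boundary, φ' (e.vertex n) = φ (e.vertex m) := by
  obtain ⟨k, rfl⟩ := Nat.exists_eq_add_of_le h
  exact ⟨φ ∘ T.parent^[k], fun e => congrArg φ (e.iterate_parent_vertex m k)⟩

theorem sector_eq_preimage {x : V} (n : ℕ) (hx : x ∈ T.level n) :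
    T.sector x = {e | e.vertex n ∈ ({x} : Set V)} := by
  ext e
  constructor
  · rintro ⟨m, rfl⟩
    have : T.graph.dist T.root (e.vertex m) = n := hx
    rw [e.dist_vertex] at this
    subst this
    rfl
  · intro h
    exact ⟨n, h⟩

/-- A vertex determines its ancestors, so two cylinders can be written over a common level, where
set operations act on the sets of vertices. The ring property yields approximation of measurable
sets by cylinders. -/
theorem isSetRing_cylinders (T : BranchingTree V) :
    IsSetRing {A : Set T.Boundary | ∃ (m : ℕ) (S : Set V), A = {e | e.vertex m ∈ S}} := by
  have key : ∀ (m n : ℕ) (S S' : Set V), ∃ (k : ℕ) (R R' : Set V),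
      {e : T.Boundary | e.vertex m ∈ S} = {e | e.vertex k ∈ R} ∧
      {e : T.Boundary | e.vertex n ∈ S'} = {e | e.vertex k ∈ R'} := by
    intro m n S S'
    obtain ⟨R, hR⟩ := exists_vertex_eq_of_le (T := T) (le_max_left m n) (fun x => x ∈ S)
    obtain ⟨R', hR'⟩ := exists_vertex_eq_of_le (T := T) (le_max_right m n) (fun x => x ∈ S')
    refine ⟨max m n, {x | R x}, {x | R' x}, ?_, ?_⟩
    · ext e; exact (iff_of_eq (hR e)).symm
    · ext e; exact (iff_of_eq (hR' e)).symm
  refine ⟨⟨0, ∅, by simp⟩, ?_, ?_⟩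
  · rintro _ _ ⟨m, S, rfl⟩ ⟨n, S', rfl⟩
    obtain ⟨k, R, R', h, h'⟩ := key m n S S'
    rw [h, h']
    exact ⟨k, R ∪ R', rfl⟩
  · rintro _ _ ⟨m, S, rfl⟩ ⟨n, S', rfl⟩
    obtain ⟨k, R, R', h, h'⟩ := key m n S S'
    rw [h, h']
    exact ⟨k, R \ R', rfl⟩

theorem measurableSet_cylinder (m : ℕ) (S : Set V) :
    MeasurableSet {e : T.Boundary | e.vertex m ∈ S} := by
  have h : MeasurableSet ((fun e : T.Boundary => e.vertex m ∈ S) ⁻¹' {True}) :=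
    measurable_vertex (fun x => x ∈ S) m trivial
  simpa [Set.preimage] using h

theorem generateFrom_cylinders (T : BranchingTree V) :
    (inferInstance : MeasurableSpace T.Boundary) = MeasurableSpace.generateFrom
      {A : Set T.Boundary | ∃ (m : ℕ) (S : Set V), A = {e | e.vertex m ∈ S}} := by
  apply le_antisymm
  · refine iSup_le fun n => MeasurableSpace.generateFrom_le ?_
    rintro _ ⟨x, hx, rfl⟩
    exact MeasurableSpace.measurableSet_generateFrom ⟨n, {x}, sector_eq_preimage n hx⟩
  · refine MeasurableSpace.generateFrom_le ?_
    rintro _ ⟨m, S, rfl⟩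
    exact measurableSet_cylinder m S

open scoped symmDiff ENNReal

variable {μ : Measure T.Boundary} [IsFiniteMeasure μ]

theorem exists_cylinder_symmDiff_lt {A : Set T.Boundary} (hA : MeasurableSet A) {ε : ℝ≥0∞}
    (hε : 0 < ε) : ∃ (m : ℕ) (S : Set V), μ ({e | e.vertex m ∈ S} ∆ A) < ε := by
  obtain ⟨_, ⟨m, S, rfl⟩, h⟩ := exists_measure_symmDiff_lt_of_generateFrom_isSetRing (μ := μ)
    T.isSetRing_cylinders ⟨{Set.univ}, Set.countable_singleton _,
      Set.singleton_subset_iff.2 ⟨0, Set.univ, by simp⟩, by simp⟩ T.generateFrom_cylinders hA hε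
  exact ⟨m, S, h⟩

/-- Simple functions on the boundary agree with functions of a vertex off small sets. -/
theorem exists_vertex_ne_simpleFunc_lt {E : Type*} [Nonempty E] (g : SimpleFunc T.Boundary E)
    {ε : ℝ≥0∞} (hε : 0 < ε) :
    ∃ (m : ℕ) (φ : V → E), μ {e | φ (e.vertex m) ≠ g e} < ε := by
  classical
  induction g using SimpleFunc.induction' generalizing ε with
  | const c => exact ⟨0, fun _ => c, by simpa using hε⟩
  | @pcw f g s hs hf hg =>
    have h3 : 0 < ε / 3 := ENNReal.div_pos hε.ne' (by simp)
    obtain ⟨m₁, φ₁, h₁⟩ := hf h3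
    obtain ⟨m₂, φ₂, h₂⟩ := hg h3
    obtain ⟨m₃, S, hS⟩ := exists_cylinder_symmDiff_lt (μ := μ) hs h3
    -- Both approximants and the cylinder are lifted to one level. An error can arise only where one
    -- of the two approximants fails or the cylinder differs from `s`.
    set m := max (max m₁ m₂) m₃
    obtain ⟨ψ₁, k₁⟩ := exists_vertex_eq_of_le (T := T) (m := m₁) (n := m) (by omega) φ₁
    obtain ⟨ψ₂, k₂⟩ := exists_vertex_eq_of_le (T := T) (m := m₂) (n := m) (by omega) φ₂
    obtain ⟨R, k₃⟩ := exists_vertex_eq_of_le (T := T) (m := m₃) (n := m) (by omega)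
      (fun x => x ∈ S)
    refine ⟨m, fun x => if R x then ψ₁ x else ψ₂ x, ?_⟩
    calc μ _ ≤ μ ({e | φ₁ (e.vertex m₁) ≠ f e} ∪ {e | φ₂ (e.vertex m₂) ≠ g e} ∪
          ({e | e.vertex m₃ ∈ S} ∆ s)) := by
            refine measure_mono fun e he => ?_
            simp only [Set.mem_ofPred_eq, k₁, k₂, k₃, SimpleFunc.coe_piecewise, Set.piecewise] at he
            simp only [Set.mem_union, Set.mem_symmDiff, Set.mem_ofPred_eq]
            by_cases a : e.vertex m₃ ∈ S <;> by_cases b : e ∈ s <;> simp_all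
      _ ≤ _ := (measure_union_le _ _).trans (add_le_add_left (measure_union_le _ _) _)
      _ < ε / 3 + ε / 3 + ε / 3 := by gcongr
      _ = ε := ENNReal.add_thirds ε

/-- Measurable functions on the boundary are approximated in measure by the functions of a vertex
given by a dense sequence. -/
theorem exists_denseSeq_dist_lt {E : Type*} [MetricSpace E] [Nonempty E]
    [TopologicalSpace.SeparableSpace (V → E)] {g : T.Boundary → E} (hg : StronglyMeasurable g)
    {ε : ℝ} (hε : 0 < ε) : ∃ m k : ℕ,
      μ {e | ε ≤ dist (TopologicalSpace.denseSeq (V → E) k (e.vertex m)) (g e)}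
        < ENNReal.ofReal ε := by
  have h2 : 0 < ENNReal.ofReal ε / 2 := ENNReal.div_pos (by simpa using hε) (by simp)
  have h := tendstoInMeasure_iff_dist.1 (tendstoInMeasure_of_tendsto_ae (μ := μ)
    (fun n => (hg.approx n).stronglyMeasurable.aestronglyMeasurable)
    (Eventually.of_forall hg.tendsto_approx)) (ε / 2) (by positivity)
  obtain ⟨n, hn⟩ := (h.eventually (gt_mem_nhds h2)).exists
  obtain ⟨m, φ, hφ⟩ := exists_vertex_ne_simpleFunc_lt (μ := μ) (hg.approx n) h2
  -- Since the level is finite, closeness to `φ` on all of it is an open condition in the product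
  -- topology, so a member of the dense sequence satisfies it.
  have hopen : IsOpen ((T.level m).pi fun x => Metric.ball (φ x) (ε / 2)) :=
    isOpen_set_pi (T.finite_level m) fun _ _ => Metric.isOpen_ball
  obtain ⟨k, hk⟩ := (TopologicalSpace.denseRange_denseSeq (V → E)).exists_mem_open hopen
    ⟨φ, fun x _ => Metric.mem_ball_self (by positivity)⟩
  refine ⟨m, k, ?_⟩
  calc μ _ ≤ μ ({e | ε / 2 ≤ dist (hg.approx n e) (g e)} ∪
        {e | φ (e.vertex m) ≠ hg.approx n e}) := by
          refine measure_mono fun e he => ?_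
          by_contra hc
          simp only [Set.mem_union, Set.mem_ofPred_eq, not_or, not_le, not_not] at hc he
          have h1 := Metric.mem_ball.1 (hk (e.vertex m) (e.dist_vertex m))
          rw [hc.2] at h1
          linarith [dist_triangle (TopologicalSpace.denseSeq (V → E) k (e.vertex m))
            (hg.approx n e) (g e)]
    _ ≤ _ := measure_union_le _ _
    _ < ENNReal.ofReal ε / 2 + ENNReal.ofReal ε / 2 := by gcongr
    _ = _ := ENNReal.add_halves _

end BranchingTree

/-! ### Rare children and steering a harmonic function to a target -/

namespace TransitionWeights

variable {V : Type*} {T : BranchingTree V} (Q : TransitionWeights T)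

/-- Two weights above one half would already have sum above `1`; this is where branching enters. -/
theorem exists_child_le_half (x : V) : ∃ y ∈ T.children x, Q.q x y ≤ 1 / 2 := by
  by_contra! h
  have hc : 2 ≤ (T.children x).card := by
    have h2 := T.two_le_ncard x
    rwa [show {y | T.graph.Adj x y ∧ T.graph.dist T.root y = T.graph.dist T.root x + 1} =
      (T.children x : Set V) by ext y; simp [T.mem_children], Set.ncard_coe_finset] at h2
  have hne : (T.children x).Nonempty := Finset.card_pos.1 (by omega)
  have h1 := Finset.sum_lt_sum_of_nonempty hne h
  rw [Q.sum_eq_one, Finset.sum_const, nsmul_eq_mul] at h1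
  have : (2 : ℝ) ≤ (T.children x).card := by exact_mod_cast hc
  linarith

/-- A child of `x` to which the probability of a move is at most one half. -/
noncomputable def rareChild (x : V) : V := (Q.exists_child_le_half x).choose

theorem rareChild_mem (x : V) : Q.rareChild x ∈ T.children x :=
  (Q.exists_child_le_half x).choose_spec.1

theorem rareChild_le (x : V) : Q.q x (Q.rareChild x) ≤ 1 / 2 :=
  (Q.exists_child_le_half x).choose_spec.2

theorem q_le_one {x y : V} (h : y ∈ T.children x) : Q.q x y ≤ 1 := by
  rw [← Q.sum_eq_one x]
  exact Finset.single_le_sum (f := Q.q x) (fun z hz => (Q.pos x z hz).le) h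

open scoped ENNReal

/-- The vertex at level `M` and the rule for the next `k` moves fix the vertex at level `M + k`.
Hence the set lies in one sector, whose measure is a product with its last `k` factors at most one
half. -/
theorem measure_rareChild_le (x : V) (M k : ℕ) :
    Q.boundaryMeasure {e | e.vertex M = x ∧
      ∀ j < k, e.vertex (M + j + 1) = Q.rareChild (e.vertex (M + j))} ≤ 2⁻¹ ^ k := by
  rcases Set.eq_empty_or_nonempty {e : T.Boundary | e.vertex M = x ∧
      ∀ j < k, e.vertex (M + j + 1) = Q.rareChild (e.vertex (M + j))} with h | ⟨e, he⟩
  · rw [h]; simp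
  · calc _ ≤ Q.boundaryMeasure (T.sector (e.vertex (M + k))) := by
          refine measure_mono fun e' he' => BranchingTree.mem_sector_vertex.2 ?_
          have key : ∀ j ≤ k, e'.vertex (M + j) = e.vertex (M + j) := by
            intro j
            induction j with
            | zero => intro _; exact he'.1.trans he.1.symm
            | succ j ih =>
              intro hj
              rw [← add_assoc, he'.2 j (by omega), he.2 j (by omega), ih (by omega)]
          exact key k le_rfl
      _ = _ := Q.boundaryMeasure_sector e (M + k)
      _ ≤ 2⁻¹ ^ k := by
          rw [Finset.prod_range_add]
          calc _ ≤ (1 : ℝ≥0∞) * ∏ _j ∈ Finset.range k, 2⁻¹ := by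
                refine mul_le_mul' (Finset.prod_le_one' fun j _ => ?_)
                  (Finset.prod_le_prod' fun j hj => ?_)
                · exact ENNReal.ofReal_le_one.2 (Q.q_le_one (e.vertex_mem_children j))
                · change ENNReal.ofReal (Q.q _ (e.vertex (M + j + 1))) ≤ _
                  rw [he.2 j (Finset.mem_range.1 hj)]
                  refine (ENNReal.ofReal_le_ofReal (Q.rareChild_le _)).trans_eq ?_
                  rw [one_div, ENNReal.ofReal_inv_of_pos (by norm_num)]
                  simp
            _ = _ := by simp

/-- Sum the previous bound over the finitely many vertices of level `M`. -/
theorem tendsto_measure_rareChild (M : ℕ) :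
    Tendsto (fun k => Q.boundaryMeasure {e | ∀ j < k,
      e.vertex (M + j + 1) = Q.rareChild (e.vertex (M + j))}) atTop (𝓝 0) := by
  have hfin := T.finite_level M
  have hlim : Tendsto (fun k : ℕ => (hfin.toFinset.card : ℝ≥0∞) * 2⁻¹ ^ k) atTop (𝓝 0) := by
    have h := ENNReal.Tendsto.const_mul (a := (hfin.toFinset.card : ℝ≥0∞))
      (ENNReal.tendsto_pow_atTop_nhds_zero_of_lt_one (r := 2⁻¹) (by simp))
      (Or.inr (by simp))
    rwa [mul_zero] at h
  refine tendsto_of_tendsto_of_tendsto_of_le_of_le tendsto_const_nhds hlim (fun _ => zero_le)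
    fun k => ?_
  calc _ ≤ Q.boundaryMeasure (⋃ x ∈ hfin.toFinset, {e | e.vertex M = x ∧
          ∀ j < k, e.vertex (M + j + 1) = Q.rareChild (e.vertex (M + j))}) := by
        refine measure_mono fun e he => ?_
        simp only [Set.mem_iUnion]
        exact ⟨e.vertex M, hfin.mem_toFinset.2 (e.dist_vertex M), rfl, he⟩
    _ ≤ ∑ x ∈ hfin.toFinset, 2⁻¹ ^ k :=
        (measure_biUnion_finset_le _ _).trans
          (Finset.sum_le_sum fun x _ => Q.measure_rareChild_le x M k)
    _ = _ := by rw [Finset.sum_const, nsmul_eq_mul]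

section Extension

variable {𝕜 E : Type*} [RCLike 𝕜] [AddCommGroup E] [Module 𝕜 E]

open Classical in
/-- The factor by which the deviation from the target is multiplied on the way to `y`. -/
noncomputable def deviationFactor (𝕜 : Type*) [RCLike 𝕜] (y : V) : 𝕜 :=
  if y = Q.rareChild (T.parent y) then (Q.q (T.parent y) y : 𝕜)⁻¹ else 0

/-- The factor has mean `1` at each vertex, so multiplying a deviation by it preserves harmonicity.
-/
theorem sum_mul_deviationFactor (x : V) :
    ∑ y ∈ T.children x, (Q.q x y : 𝕜) * Q.deviationFactor 𝕜 y = 1 := by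
  rw [Finset.sum_eq_single_of_mem _ (Q.rareChild_mem x)]
  · have h := Q.pos x _ (Q.rareChild_mem x)
    rw [deviationFactor, BranchingTree.parent_eq (Q.rareChild_mem x), if_pos rfl]
    exact mul_inv_cancel₀ (by exact_mod_cast h.ne')
  · intro y hy hne
    rw [deviationFactor, BranchingTree.parent_eq hy, if_neg hne, mul_zero]

/-- A harmonic function can be altered beyond a level so that, along the geodesics, it attains
eventually the values of a given function of a vertex, off small sets. -/
theorem exists_harmonic_tendsto_measure_ne (h : Q.harmonic 𝕜 E) (N m : ℕ) (φ : V → E) :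
    ∃ h' : Q.harmonic 𝕜 E,
      (∀ x, T.graph.dist T.root x ≤ N → (h' : V → E) x = (h : V → E) x) ∧
      Tendsto (fun n => Q.boundaryMeasure
        {e | (h' : V → E) (e.vertex n) ≠ φ (e.vertex m)}) atTop (𝓝 0) := by
  set M := max N m
  -- The new function is `ψ + C • D`. Beyond level `M`, `ψ` is the target read off at the ancestor
  -- of level `m`, `D` is the deviation of `h` from it frozen at level `M`, and `C` is the product
  -- of the factors met since then.
  set ψ : V → E := fun x => φ (T.parent^[T.graph.dist T.root x - m] x) with hψ
  set C : V → 𝕜 := fun x => ∏ i ∈ Finset.range (T.graph.dist T.root x - M),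
    Q.deviationFactor 𝕜 (T.parent^[i] x) with hC
  set D : V → E := fun x => (h : V → E) (T.parent^[T.graph.dist T.root x - M] x) -
    ψ (T.parent^[T.graph.dist T.root x - M] x) with hD
  have hψc : ∀ x, M ≤ T.graph.dist T.root x → ∀ y ∈ T.children x, ψ y = ψ x := by
    intro x hx y hy
    have hx' : m ≤ T.graph.dist T.root x := (le_max_right _ _).trans hx
    simp only [hψ, BranchingTree.dist_of_mem_children hy]
    rw [Nat.sub_add_comm hx', Function.iterate_succ_apply, BranchingTree.parent_eq hy]
  have hDc : ∀ x, M ≤ T.graph.dist T.root x → ∀ y ∈ T.children x, D y = D x := by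
    intro x hx y hy
    simp only [hD, BranchingTree.dist_of_mem_children hy]
    rw [Nat.sub_add_comm hx, Function.iterate_succ_apply, BranchingTree.parent_eq hy]
  have hCc : ∀ x, M ≤ T.graph.dist T.root x → ∀ y ∈ T.children x,
      C y = Q.deviationFactor 𝕜 y * C x := by
    intro x hx y hy
    simp only [hC, BranchingTree.dist_of_mem_children hy]
    rw [Nat.sub_add_comm hx, Finset.prod_range_succ', mul_comm]
    simp only [Function.iterate_succ_apply, BranchingTree.parent_eq hy, Function.iterate_zero, id]
  -- Up to level `M` the truncated difference is `0`, so `C = 1` and `D = h - ψ`; the value of `ψ`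
  -- cancels.
  have hlow : ∀ x, T.graph.dist T.root x ≤ M → ψ x + C x • D x = (h : V → E) x := by
    intro x hx
    simp [hC, hD, Nat.sub_eq_zero_of_le hx]
  refine ⟨⟨fun x => ψ x + C x • D x, fun x => ?_⟩, fun x hx => hlow x (hx.trans (le_max_left _ _)),
    ?_⟩
  · rcases lt_or_ge (T.graph.dist T.root x) M with hx | hx
    · change ψ x + C x • D x = ∑ y ∈ T.children x, (Q.q x y : 𝕜) • (ψ y + C y • D y)
      rw [hlow x hx.le, h.2 x]
      refine Finset.sum_congr rfl fun y hy => ?_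
      rw [hlow y]
      rw [BranchingTree.dist_of_mem_children hy]
      exact hx
    · calc ψ x + C x • D x = (∑ y ∈ T.children x, (Q.q x y : 𝕜)) • ψ x +
            (∑ y ∈ T.children x, (Q.q x y : 𝕜) * Q.deviationFactor 𝕜 y) • C x • D x := by
            rw [Q.sum_mul_deviationFactor, ← RCLike.ofReal_sum, Q.sum_eq_one]
            simp
        _ = ∑ y ∈ T.children x, (Q.q x y : 𝕜) • (ψ y + C y • D y) := by
            rw [Finset.sum_smul, Finset.sum_smul, ← Finset.sum_add_distrib]
            refine Finset.sum_congr rfl fun y hy => ?_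
            rw [hψc x hx y hy, hDc x hx y hy, hCc x hx y hy, smul_add, mul_smul, mul_smul]
  · rw [← tendsto_add_atTop_iff_nat M]
    refine tendsto_of_tendsto_of_tendsto_of_le_of_le tendsto_const_nhds
      (Q.tendsto_measure_rareChild M) (fun _ => zero_le) fun k => measure_mono fun e he => ?_
    -- A nonzero product has no zero factor, so the geodesic has moved to the rare child at every
    -- step since level `M`.
    have hkey : ∀ k, ψ (e.vertex (M + k)) = φ (e.vertex m) ∧
        (C (e.vertex (M + k)) ≠ 0 →
          ∀ j < k, e.vertex (M + j + 1) = Q.rareChild (e.vertex (M + j))) := by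
      intro k
      constructor
      · simp only [hψ, e.dist_vertex]
        obtain ⟨l, hl⟩ := Nat.exists_eq_add_of_le
          (show m ≤ M + k from (le_max_right N m).trans (Nat.le_add_right _ _))
        rw [hl, Nat.add_sub_cancel_left, e.iterate_parent_vertex]
      · induction k with
        | zero => intro _ j hj; omega
        | succ k ih =>
          intro hne j hj
          have hmem := e.vertex_mem_children (M + k)
          rw [← add_assoc, hCc (e.vertex (M + k)) (by rw [e.dist_vertex]; omega) _ hmem] at hne
          rcases Nat.lt_succ_iff_lt_or_eq.1 hj with hj | rfl
          · exact ih (right_ne_zero_of_mul hne) j hj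
          · have := left_ne_zero_of_mul hne
            rw [deviationFactor, BranchingTree.parent_eq hmem] at this
            by_contra hc
            exact this (if_neg hc)
    refine (hkey k).2 fun h0 => he ?_
    change ψ (e.vertex (k + M)) + C (e.vertex (k + M)) • D (e.vertex (k + M)) = _
    rw [add_comm k M, h0, zero_smul, add_zero, (hkey k).1]

end Extension

end TransitionWeights

/-- By translation invariance of the metric, continuity of `x ↦ a • x` at `0` is uniform continuity,
which preserves convergence in measure. -/
theorem MeasureTheory.TendstoInMeasure.const_smul_of_isIsometricVAdd {Ω ι 𝕜 E : Type*}
    [MeasurableSpace Ω] {μ : Measure Ω} [RCLike 𝕜] [AddCommGroup E] [Module 𝕜 E] [MetricSpace E]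
    [IsIsometricVAdd E E] [ContinuousSMul 𝕜 E] {l : Filter ι} {f : ι → Ω → E} {g : Ω → E}
    (h : TendstoInMeasure μ f l g) (a : 𝕜) :
    TendstoInMeasure μ (fun i ω => a • f i ω) l (fun ω => a • g ω) := by
  rw [tendstoInMeasure_iff_dist] at h ⊢
  intro ε hε
  have hdist : ∀ x y : E, dist x y = dist (x - y) 0 := fun x y => by
    rw [← dist_add_left (-y) x y, neg_add_cancel, neg_add_eq_sub]
  have hc : ContinuousAt (fun x : E => a • x) 0 := (continuous_const_smul a).continuousAt
  obtain ⟨δ, hδ, H⟩ := Metric.continuousAt_iff.1 hc ε hε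
  refine tendsto_of_tendsto_of_tendsto_of_le_of_le tendsto_const_nhds (h δ hδ)
    (fun _ => zero_le) fun i => measure_mono fun ω hω => ?_
  by_contra hlt
  simp only [Set.mem_ofPred_eq, not_le] at hlt hω
  rw [hdist] at hlt
  have := H hlt
  rw [smul_zero, smul_sub, ← hdist] at this
  linarith

/-! ### Harmonic functions that attain a sequence of targets -/

namespace TransitionWeights

variable {V : Type*} {T : BranchingTree V} (Q : TransitionWeights T)

open scoped ENNReal

section Construction

variable {𝕜 E : Type*} [RCLike 𝕜] [AddCommGroup E] [Module 𝕜 E]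

/-- There are harmonic functions with prescribed values up to a level that attain each function
out of a given sequence, off arbitrarily small sets, at infinitely many of the given levels. -/
theorem exists_harmonic_frequently_eq (g : Q.harmonic 𝕜 E) (N : ℕ) {σ : ℕ → ℕ}
    (hσ : StrictMono σ) (φ : ℕ → V → E) :
    ∃ f : Q.harmonic 𝕜 E,
      (∀ x, T.graph.dist T.root x ≤ N → (f : V → E) x = (g : V → E) x) ∧
      ∀ (m k : ℕ) (ε : ℝ≥0∞), 0 < ε → ∀ i₀, ∃ i ≥ i₀, Q.boundaryMeasure
        {e | (f : V → E) (e.vertex (σ i)) ≠ φ k (e.vertex m)} < ε := by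
  -- The stage `s` encodes `((m, k), t)`, so each target `(m, k)` recurs infinitely often. The
  -- second component of a state is the level up to which later stages change nothing; it is moved
  -- past `σ i` to preserve the hit.
  have step : ∀ (s : ℕ) (a : Q.harmonic 𝕜 E × ℕ), ∃ b : Q.harmonic 𝕜 E × ℕ,
      (∀ x, T.graph.dist T.root x ≤ a.2 → (b.1 : V → E) x = (a.1 : V → E) x) ∧ a.2 < b.2 ∧
      ∃ i ≥ s, σ i ≤ b.2 ∧ Q.boundaryMeasure {e | (b.1 : V → E) (e.vertex (σ i)) ≠
        φ s.unpair.1.unpair.2 (e.vertex s.unpair.1.unpair.1)} < 2⁻¹ ^ s := by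
    intro s a
    obtain ⟨h', h1, h2⟩ := Q.exists_harmonic_tendsto_measure_ne a.1 a.2 s.unpair.1.unpair.1
      (φ s.unpair.1.unpair.2)
    obtain ⟨i, hi, his⟩ := (((h2.comp hσ.tendsto_atTop).eventually
      (gt_mem_nhds (show (0 : ℝ≥0∞) < 2⁻¹ ^ s from ENNReal.pow_pos (by simp) s))).and
      (eventually_ge_atTop s)).exists
    exact ⟨(h', max (a.2 + 1) (σ i)), h1, Nat.lt_of_succ_le (le_max_left _ _), i, his,
      le_max_right _ _, hi⟩
  choose next hagree hlt hhit using step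
  let a : ℕ → Q.harmonic 𝕜 E × ℕ := fun n => Nat.rec (g, N) next n
  have hmono : StrictMono fun s => (a s).2 := strictMono_nat_of_lt_succ fun s => hlt s (a s)
  have hstable : ∀ s t, s ≤ t → ∀ x, T.graph.dist T.root x ≤ (a s).2 →
      ((a t).1 : V → E) x = ((a s).1 : V → E) x := by
    intro s t hst x hx
    induction t, hst using Nat.le_induction with
    | base => rfl
    | succ t hst ih => rw [← ih]; exact hagree t (a t) x (hx.trans (hmono.monotone hst))
  -- The frozen levels increase strictly, so stage `n` has already settled the values at level `n`.
  let F : V → E := fun x => ((a (T.graph.dist T.root x)).1 : V → E) x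
  have hF : ∀ s x, T.graph.dist T.root x ≤ (a s).2 → F x = ((a s).1 : V → E) x := by
    intro s x hx
    rw [← hstable s _ (le_max_left s (T.graph.dist T.root x)) x hx,
      hstable _ _ (le_max_right s (T.graph.dist T.root x)) x (hmono.le_apply)]
  refine ⟨⟨F, fun x => ?_⟩, hF 0, ?_⟩
  -- One more stage is needed for the children of `x` to be settled too.
  · have hs := hmono.le_apply (x := T.graph.dist T.root x + 1)
    rw [hF (T.graph.dist T.root x + 1) x (by omega), (a (T.graph.dist T.root x + 1)).1.2 x]
    refine Finset.sum_congr rfl fun y hy => ?_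
    rw [hF (T.graph.dist T.root x + 1) y (by rw [BranchingTree.dist_of_mem_children hy]; exact hs)]
  · intro m k ε hε i₀
    obtain ⟨t, ht, hti⟩ := (((ENNReal.tendsto_pow_atTop_nhds_zero_of_lt_one (r := 2⁻¹)
      (by simp)).eventually (gt_mem_nhds hε)).and (eventually_ge_atTop i₀)).exists
    -- As `t ≤ s`, this stage has error below `2⁻ˢ ≤ 2⁻ᵗ < ε` and index `i ≥ s ≥ t ≥ i₀`.
    set s := Nat.pair (Nat.pair m k) t with hs
    have hts : t ≤ s := Nat.right_le_pair _ _
    obtain ⟨i, his, hiN, hi⟩ := hhit s (a s)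
    refine ⟨i, by omega, lt_of_eq_of_lt ?_ (hi.trans
      (lt_of_le_of_lt (pow_le_pow_right_of_le_one' (by simp) hts) ht))⟩
    have h1 : s.unpair.1.unpair = (m, k) := by simp [hs]
    rw [h1]
    congr 1
    ext e
    change F _ ≠ _ ↔ _
    rw [hF (s + 1) _ (by rw [e.dist_vertex]; exact hiN)]
    rfl

/-- The harmonic functions that vanish off small sets at the levels `σ i`, for large `i`. -/
def nullAlong (𝕜 E : Type*) [RCLike 𝕜] [AddCommGroup E] [Module 𝕜 E] (σ : ℕ → ℕ) :
    Submodule 𝕜 (Q.harmonic 𝕜 E) where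
  carrier := {f | Tendsto (fun i => Q.boundaryMeasure {e | (f : V → E) (e.vertex (σ i)) ≠ 0})
    atTop (𝓝 0)}
  zero_mem' := by simp
  add_mem' {f g} hf hg := by
    have h := hf.add hg
    rw [add_zero] at h
    refine tendsto_of_tendsto_of_tendsto_of_le_of_le tendsto_const_nhds h (fun _ => zero_le)
      fun i => (measure_mono fun e he => ?_).trans (measure_union_le _ _)
    by_contra hc
    simp only [Set.mem_union, Set.mem_ofPred_eq, not_or, not_not] at hc
    apply he
    rw [Submodule.coe_add, Pi.add_apply, hc.1, hc.2, add_zero]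
  smul_mem' c f hf := by
    refine tendsto_of_tendsto_of_tendsto_of_le_of_le tendsto_const_nhds hf (fun _ => zero_le)
      fun i => measure_mono fun e he hc => he ?_
    rw [Submodule.coe_smul, Pi.smul_apply, hc, smul_zero]

theorem nullAlong_le_comp (σ : ℕ → ℕ) {ρ : ℕ → ℕ} (hρ : StrictMono ρ) :
    Q.nullAlong 𝕜 E σ ≤ Q.nullAlong 𝕜 E (σ ∘ ρ) :=
  fun f (hf : Tendsto (fun i => Q.boundaryMeasure {e | (f : V → E) (e.vertex (σ i)) ≠ 0})
    atTop (𝓝 0)) => hf.comp hρ.tendsto_atTop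

end Construction

/-! ### Universality along sequences of levels and dense linear spaces -/

variable {E : Type*} [MetricSpace E]

/-- Each measurable function on the boundary is the limit in probability of a subsequence of the
functions `ω_{σ i}(f)`. -/
def UniversalAlongSeq (σ : ℕ → ℕ) (f : V → E) : Prop :=
  ∀ Ψ : T.Boundary → E, StronglyMeasurable Ψ → ∃ l : ℕ → ℕ, Tendsto l atTop atTop ∧
    TendstoInMeasure Q.boundaryMeasure (fun n => T.boundaryFun (σ (l n)) f) atTop Ψ

variable {Q}

theorem UniversalAlongSeq.of_comp {σ ρ : ℕ → ℕ} {f : V → E} (hρ : StrictMono ρ)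
    (h : Q.UniversalAlongSeq (σ ∘ ρ) f) : Q.UniversalAlongSeq σ f := by
  intro Ψ hΨ
  obtain ⟨l, h1, h2⟩ := h Ψ hΨ
  exact ⟨ρ ∘ l, hρ.tendsto_atTop.comp h1, h2⟩

variable {𝕜 : Type*} [RCLike 𝕜] [AddCommGroup E] [Module 𝕜 E]

/-- To reach `Ψ`, steer `f` to `a⁻¹ • Ψ`; the summand `g` vanishes off sets of measure tending to
`0`. -/
theorem UniversalAlongSeq.smul_add [IsIsometricVAdd E E] [ContinuousSMul 𝕜 E] {σ : ℕ → ℕ}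
    {f g : Q.harmonic 𝕜 E} (hf : Q.UniversalAlongSeq σ (f : V → E)) (hg : g ∈ Q.nullAlong 𝕜 E σ)
    {a : 𝕜} (ha : a ≠ 0) : Q.UniversalAlongSeq σ ((a • f + g : Q.harmonic 𝕜 E) : V → E) := by
  intro Ψ hΨ
  obtain ⟨l, hl, h⟩ := hf (fun e => a⁻¹ • Ψ e) (hΨ.const_smul a⁻¹)
  refine ⟨l, hl, ?_⟩
  have h1 := h.const_smul_of_isIsometricVAdd a
  simp only [smul_inv_smul₀ ha] at h1
  intro ε hε
  have h2 := (h1 ε hε).add (Tendsto.comp hg hl)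
  rw [add_zero] at h2
  refine tendsto_of_tendsto_of_tendsto_of_le_of_le tendsto_const_nhds h2 (fun _ => zero_le)
    fun i => (measure_mono fun e he => ?_).trans (measure_union_le _ _)
  by_contra hc
  simp only [Set.mem_union, Set.mem_ofPred_eq, not_or, not_not] at hc
  apply hc.1
  have he' : ε ≤ edist (a • (f : V → E) (e.vertex (σ (l i))) + (g : V → E) (e.vertex (σ (l i))))
    (Ψ e) := he
  rwa [hc.2, add_zero] at he'

variable (Q)

/-- There are harmonic functions with prescribed values up to a level that are universal along a
given sequence of levels, and vanish off small sets along some subsequence. -/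
theorem exists_universalAlongSeq [TopologicalSpace.SeparableSpace E] (g : Q.harmonic 𝕜 E)
    (N : ℕ) {σ : ℕ → ℕ} (hσ : StrictMono σ) :
    ∃ f : Q.harmonic 𝕜 E,
      (∀ x, T.graph.dist T.root x ≤ N → (f : V → E) x = (g : V → E) x) ∧
      Q.UniversalAlongSeq σ (f : V → E) ∧
      ∃ ρ : ℕ → ℕ, StrictMono ρ ∧ f ∈ Q.nullAlong 𝕜 E (σ ∘ ρ) := by
  have := T.countable_vertices
  have := UniformSpace.secondCountable_of_separable E
  obtain ⟨f, hfg, hf⟩ := Q.exists_harmonic_frequently_eq g N hσ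
    -- Target `0` is the zero function, which gives the null subsequence; target `k + 1` is the
    -- `k`-th member of the dense sequence.
    (fun k => Nat.casesOn k 0 (TopologicalSpace.denseSeq (V → E)))
  refine ⟨f, hfg, ?_, ?_⟩
  · intro Ψ hΨ
    have hpos : ∀ n : ℕ, (0 : ℝ) < 1 / ((n : ℝ) + 1) := fun n => Nat.one_div_pos_of_nat
    choose m k hmk using fun n : ℕ =>
      BranchingTree.exists_denseSeq_dist_lt (μ := Q.boundaryMeasure) hΨ (hpos n)
    choose l hln hl using fun n : ℕ =>
      hf (m n) (k n + 1) (ENNReal.ofReal (1 / ((n : ℝ) + 1))) (by simpa using hpos n) n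
    refine ⟨l, tendsto_atTop_mono hln tendsto_id, tendstoInMeasure_iff_dist.2 fun ε hε => ?_⟩
    have hlim : Tendsto (fun n : ℕ => ENNReal.ofReal (1 / ((n : ℝ) + 1)) +
        ENNReal.ofReal (1 / ((n : ℝ) + 1))) atTop (𝓝 0) := by
      have h := ENNReal.tendsto_ofReal (tendsto_one_div_add_atTop_nhds_zero_nat (𝕜 := ℝ))
      have h2 := h.add h
      rwa [ENNReal.ofReal_zero, add_zero] at h2
    refine tendsto_of_tendsto_of_tendsto_of_le_of_le' tendsto_const_nhds hlim
      (Eventually.of_forall fun _ => zero_le) ?_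
    filter_upwards [(tendsto_one_div_add_atTop_nhds_zero_nat (𝕜 := ℝ)).eventually
      (gt_mem_nhds hε)] with n hn
    refine ((measure_mono fun e he => ?_).trans (measure_union_le _ _)).trans
      (add_le_add (hmk n).le (hl n).le)
    by_contra hc
    simp only [Set.mem_union, Set.mem_ofPred_eq, not_or, not_not, not_le] at hc he
    rw [BranchingTree.boundaryFun, hc.2] at he
    linarith [hc.1]
  · have hfreq : ∀ n i₀ : ℕ, ∃ i > i₀, Q.boundaryMeasure
        {e | (f : V → E) (e.vertex (σ i)) ≠ 0} < 2⁻¹ ^ n := fun n i₀ =>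
      hf 0 0 (2⁻¹ ^ n) (ENNReal.pow_pos (by simp) n) (i₀ + 1)
    choose r hr hr' using hfreq
    -- Each index is chosen beyond the preceding one, with exceptional set of measure below `2⁻ⁿ`.
    let ρ : ℕ → ℕ := fun n => Nat.rec (r 0 0) (fun n i => r (n + 1) i) n
    refine ⟨ρ, strictMono_nat_of_lt_succ fun n => hr (n + 1) (ρ n), ?_⟩
    refine tendsto_of_tendsto_of_tendsto_of_le_of_le tendsto_const_nhds
      (ENNReal.tendsto_pow_atTop_nhds_zero_of_lt_one (r := 2⁻¹) (by simp)) (fun _ => zero_le)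
      fun n => ?_
    cases n with
    | zero => exact (hr' 0 0).le
    | succ n => exact (hr' (n + 1) (ρ n)).le

/-- Dense linear spaces of harmonic functions that are universal along a sequence of levels. -/
theorem exists_dense_submodule_universalAlongSeq [TopologicalSpace.SeparableSpace E]
    [IsIsometricVAdd E E] [ContinuousSMul 𝕜 E] {σ : ℕ → ℕ} (hσ : StrictMono σ) :
    ∃ W : Submodule 𝕜 (Q.harmonic 𝕜 E), Dense (W : Set (Q.harmonic 𝕜 E)) ∧
      ∀ w ∈ W, w = 0 ∨ Q.UniversalAlongSeq σ (w : V → E) := by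
  have := T.countable_vertices
  have := UniformSpace.secondCountable_of_separable E
  have : TopologicalSpace.SeparableSpace (Q.harmonic 𝕜 E) :=
    have : SecondCountableTopology (Q.harmonic 𝕜 E) :=
      TopologicalSpace.Subtype.secondCountableTopology (Q.harmonic 𝕜 E : Set (V → E))
    inferInstance
  let g : ℕ → Q.harmonic 𝕜 E := TopologicalSpace.denseSeq _
  -- The index `k` encodes `(j, N)`: the function agrees with `g j` up to level `N`. It is universal
  -- along the current sequence and null along the next one.
  have step : ∀ (k : ℕ) (s : {s : ℕ → ℕ // StrictMono s}), ∃ (f : Q.harmonic 𝕜 E)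
      (s' : {s : ℕ → ℕ // StrictMono s}),
      (∀ x, T.graph.dist T.root x ≤ k.unpair.2 → (f : V → E) x = (g k.unpair.1 : V → E) x) ∧
      Q.UniversalAlongSeq s.1 (f : V → E) ∧
      (∃ ρ : ℕ → ℕ, StrictMono ρ ∧ s'.1 = s.1 ∘ ρ) ∧ f ∈ Q.nullAlong 𝕜 E s'.1 := by
    rintro k ⟨s, hs⟩
    obtain ⟨f, h1, h2, ρ, h3, h4⟩ := Q.exists_universalAlongSeq (g k.unpair.1) k.unpair.2 hs
    exact ⟨f, ⟨s ∘ ρ, hs.comp h3⟩, h1, h2, ⟨ρ, h3, rfl⟩, h4⟩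
  choose F S hFg hFu hS hFn using step
  let s : ℕ → {s : ℕ → ℕ // StrictMono s} := fun n => Nat.rec ⟨σ, hσ⟩ S n
  let f : ℕ → Q.harmonic 𝕜 E := fun k => F k (s k)
  have hsu : ∀ (k : ℕ) (w : V → E), Q.UniversalAlongSeq (s k).1 w → Q.UniversalAlongSeq σ w := by
    intro k w
    induction k with
    | zero => exact id
    | succ k ih =>
      intro hw
      obtain ⟨ρ, hρ, h⟩ := hS k (s k)
      change Q.UniversalAlongSeq (S k (s k)).1 w at hw
      rw [h] at hw
      exact ih (hw.of_comp hρ)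
  -- Nullity passes to subsequences, so all earlier functions, and their combinations, are null
  -- along `s n`.
  have hsn : ∀ n, Submodule.span 𝕜 (f '' Set.Iio n) ≤ Q.nullAlong 𝕜 E (s n).1 := by
    intro n
    induction n with
    | zero => simp
    | succ n ih =>
      obtain ⟨ρ, hρ, h⟩ := hS n (s n)
      rw [Set.Iio_add_one_eq_Iic, ← Set.Iio_insert, Set.image_insert_eq, Submodule.span_insert]
      refine sup_le ((Submodule.span_singleton_le_iff_mem _ _).2 (hFn n (s n))) (ih.trans ?_)
      change _ ≤ Q.nullAlong 𝕜 E (S n (s n)).1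
      rw [h]
      exact Q.nullAlong_le_comp _ hρ
  have hspan : ∀ n, ∀ w ∈ Submodule.span 𝕜 (f '' Set.Iio n),
      w = 0 ∨ Q.UniversalAlongSeq σ (w : V → E) := by
    intro n
    induction n with
    | zero => intro w hw; left; simpa using hw
    | succ n ih =>
      intro w hw
      rw [Set.Iio_add_one_eq_Iic, ← Set.Iio_insert, Set.image_insert_eq,
        Submodule.mem_span_insert] at hw
      obtain ⟨a, z, hz, rfl⟩ := hw
      rcases eq_or_ne a 0 with rfl | ha
      · rw [zero_smul, zero_add]
        exact ih z hz
      · exact Or.inr (hsu n _ ((hFu n (s n)).smul_add (hsn n hz) ha))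
  refine ⟨Submodule.span 𝕜 (Set.range f), ?_, fun w hw => ?_⟩
  · refine Dense.mono Submodule.subset_span (dense_closure.1 (Dense.mono ?_
      (TopologicalSpace.denseRange_denseSeq (Q.harmonic 𝕜 E))))
    rintro _ ⟨j, rfl⟩
    -- At each vertex these functions eventually equal `g j`.
    refine mem_closure_of_tendsto (f := fun N => f (Nat.pair j N)) (b := atTop) ?_
      (Eventually.of_forall fun N => ⟨_, rfl⟩)
    rw [tendsto_subtype_rng, tendsto_pi_nhds]
    intro x
    refine tendsto_const_nhds.congr' ?_
    filter_upwards [eventually_ge_atTop (T.graph.dist T.root x)] with N hN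
    have h := hFg (Nat.pair j N) (s (Nat.pair j N)) x (by simpa using hN)
    rw [Nat.unpair_pair] at h
    exact h.symm
  · have hU : Set.range f = ⋃ n, f '' Set.Iio n := by
      rw [← Set.image_iUnion, Set.iUnion_Iio, Set.image_univ]
    rw [hU, Submodule.span_iUnion, Submodule.mem_iSup_of_directed] at hw
    · obtain ⟨n, hn⟩ := hw
      exact hspan n w hn
    · exact Monotone.directed_le fun m n h =>
        Submodule.span_mono (Set.image_mono (Set.Iio_subset_Iio h))

end TransitionWeights

/-! ### From convergence in probability to the metric of `LZero` -/

namespace LZero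

variable {Ω : Type*} [MeasurableSpace Ω] {E : Type*} [MetricSpace E] {μ : Measure Ω}

theorem toFun_mk {f : Ω → E} (hf : AEStronglyMeasurable f μ) : (mk f hf).toFun =ᵐ[μ] f :=
  AEEqFun.coeFn_mk f hf

theorem stronglyMeasurable (h : LZero E μ) : StronglyMeasurable h.toFun :=
  AEEqFun.stronglyMeasurable h

variable [IsFiniteMeasure μ]

/-- Some subsequence converges almost everywhere; as the integrand is bounded by `1`, dominated
convergence applies. -/
theorem exists_dist_lt_of_tendstoInMeasure {f : ℕ → Ω → E}
    (hf : ∀ n, AEStronglyMeasurable (f n) μ) (h : LZero E μ)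
    (hlim : TendstoInMeasure μ f atTop h.toFun) {ε : ℝ} (hε : 0 < ε) :
    ∃ n, dist h (mk (f n) (hf n)) < ε := by
  obtain ⟨ns, -, hns⟩ := hlim.exists_seq_tendsto_ae
  have key : Tendsto (fun n => ∫ ω, dist (h.toFun ω) ((mk (f (ns n)) (hf (ns n))).toFun ω) /
      (1 + dist (h.toFun ω) ((mk (f (ns n)) (hf (ns n))).toFun ω)) ∂μ) atTop
      (𝓝 (∫ _, (0 : ℝ) ∂μ)) := by
    refine tendsto_integral_of_dominated_convergence (fun _ => 1)
      (fun n => (integrable_dist _ _).aestronglyMeasurable) (integrable_const 1)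
      (fun n => Eventually.of_forall fun ω => ?_) ?_
    · rw [Real.norm_of_nonneg (by positivity), div_le_one (by positivity)]
      linarith
    · filter_upwards [hns, ae_all_iff.2 fun n => toFun_mk (hf (ns n))] with ω h1 h2
      simp only [h2]
      have h3 : Tendsto (fun n => dist (h.toFun ω) (f (ns n) ω)) atTop (𝓝 0) := by
        simpa [dist_comm] using tendsto_iff_dist_tendsto_zero.1 h1
      have h4 : Tendsto (fun n => dist (h.toFun ω) (f (ns n) ω) /
          (1 + dist (h.toFun ω) (f (ns n) ω))) atTop (𝓝 (0 / (1 + 0))) :=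
        h3.div (h3.const_add 1) (by simp)
      simpa using h4
  rw [integral_zero] at key
  obtain ⟨n, hn⟩ := (key.eventually (gt_mem_nhds hε)).exists
  exact ⟨ns n, hn⟩

end LZero

theorem corollary4p4 {V : Type*} (T : BranchingTree V) (Q : TransitionWeights T)
    {𝕜 : Type*} [RCLike 𝕜]
    -- `E` is a separable Fréchet space over `𝕜 = ℝ` or `ℂ`, with translation-invariant metric
    {E : Type*} [AddCommGroup E] [Module 𝕜 E] [Module ℝ E] [IsScalarTower ℝ 𝕜 E]
    [MetricSpace E] [IsIsometricVAdd E E] [IsTopologicalAddGroup E] [ContinuousSMul 𝕜 E]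
    [LocallyConvexSpace ℝ E] [CompleteSpace E] [TopologicalSpace.SeparableSpace E] :
    (∃ W : Submodule 𝕜 (Q.harmonic 𝕜 E),
      Dense (W : Set (Q.harmonic 𝕜 E)) ∧
      (W : Set (Q.harmonic 𝕜 E)) ⊆ Q.universal 𝕜 E ∪ {0}) ∧
    (∀ τ : Set ℕ, τ.Infinite →
      ∃ W : Submodule ℂ (Q.harmonic ℂ ℂ),
        Dense (W : Set (Q.harmonic ℂ ℂ)) ∧
        (W : Set (Q.harmonic ℂ ℂ)) ⊆ Q.universalAlong τ ∪ {0}) := by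

  constructor
  · obtain ⟨W, hW, hU⟩ := Q.exists_dense_submodule_universalAlongSeq (𝕜 := 𝕜) (E := E) strictMono_id
    refine ⟨W, hW, fun w hw => (hU w hw).symm.imp_left fun h => ?_⟩
    refine Metric.dense_iff.2 fun p ε hε => ?_
    obtain ⟨l, -, hl⟩ := h p.toFun p.stronglyMeasurable
    obtain ⟨n, hn⟩ := LZero.exists_dist_lt_of_tendstoInMeasure
      (fun n => BranchingTree.aestronglyMeasurable_boundaryFun (l n) _ _) p hl hε
    exact ⟨_, Metric.mem_ball'.2 hn, l n, rfl⟩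
  · intro τ hτ
    -- The levels are the increasing enumeration of `τ`.
    obtain ⟨W, hW, hU⟩ := Q.exists_dense_submodule_universalAlongSeq (𝕜 := ℂ) (E := ℂ)
      (Nat.nth_strictMono hτ)
    refine ⟨W, hW, fun w hw => (hU w hw).symm.imp_left fun h Ψ hΨ => ?_⟩
    obtain ⟨l, -, hl⟩ := h Ψ hΨ.stronglyMeasurable
    exact ⟨_, fun n => Nat.nth_mem_of_infinite hτ (l n), hl⟩
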